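/- Let $n\in\mathbb N$ and $\lambda>0$. Let $G$ be the $(2n+1)$-dimensional Heisenberg group, that is, $\mathbb R^n\times\mathbb R^n\times\mathbb R$ with the multiplication $$[a,b,c]\,[a',b',c']=\bigl[a+a',\,b+b',\,c+c'+\tfrac12(a\cdot b'-a'\cdot b)\bigr],$$ and let $\pi$ be its Schrödinger representation on the complex Hilbert space $L^2(\mathbb R^n)$, $$\bigl(\pi([a,b,c])f\bigr)(x)=e^{i\lambda(c-b\cdot x+\frac12 a\cdot b)}f(x-a).$$ Let $\phi(x)=\left(\frac{\lambda}{\pi}\right)^{n/4}e^{-\lambda|x|^2/2}$ (here $\pi$ is the number), so that $\|\phi\|_2=1$, and for $z=(a,b)\in\mathbb R^{2n}$ let $\phi_z=\pi([a,b,0])\phi$ be the corresponding coherent state. For a bounded operator $A$ on $L^2(\mathbb R^n)$ define its Berezin covariant symbol by $$S(A)(z)=(A\phi_z\mid\phi_z)_{L^2(\mathbb R^n)},\qquad z\in\mathbb R^{2n}.$$ Let $\mathfrak S_2(L^2(\mathbb R^n))$ be the space of Hilbert–Schmidt operators on $L^2(\mathbb R^n)$ with the Hilbert–Schmidt norm.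 Then $S(A)\in L^2(\mathbb R^{2n})$ (with respect to Lebesgue measure) for every $A\in\mathfrak S_2(L^2(\mathbb R^n))$, and the map $S\colon\mathfrak S_2(L^2(\mathbb R^n))\to L^2(\mathbb R^{2n})$ is a bounded linear operator which is injective and has dense range. -/

import Mathlib

open MeasureTheory
open scoped ENNReal

noncomputable section

/-! ### Hilbert-Schmidt operators on a complex Hilbert space -/

section HilbertSchmidt

set_option linter.unusedSectionVars false

variable {H : Type*} [NormedAddCommGroup H] [InnerProductSpace ℂ H] [CompleteSpace H]

/-- The sum `∑ ‖A e_i‖ ^ 2 ∈ [0, ∞]` over an orthonormal basis `(e_i)`. -/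
def hsEnergy {ι : Type*} (e : HilbertBasis ι ℂ H) (A : H →L[ℂ] H) : ℝ≥0∞ :=
  ∑' i, ‖A (e i)‖ₑ ^ 2

theorem tsum_enorm_inner_sq {ι : Type*} (e : HilbertBasis ι ℂ H) (x : H) :
    ∑' i, ‖inner ℂ (e i) x‖ₑ ^ 2 = ‖x‖ₑ ^ 2 := by
  have h1 := (e.hasSum_inner_mul_inner x x).mapL Complex.reCLM
  have h2 : HasSum (fun i => ‖inner ℂ (e i) x‖ ^ 2) (‖x‖ ^ 2) := by
    have e1 : (fun i => Complex.reCLM (inner ℂ x (e i) * inner ℂ (e i) x)) =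
        fun i => ‖inner ℂ (e i) x‖ ^ 2 := by
      funext i
      rw [← inner_conj_symm x (e i), RCLike.conj_mul]
      simp [← Complex.ofReal_pow]
    have e2 : Complex.reCLM (inner ℂ x x) = ‖x‖ ^ 2 := by
      rw [inner_self_eq_norm_sq_to_K]
      simp [← Complex.ofReal_pow]
    rw [e1, e2] at h1
    exact h1
  have h3 := ENNReal.ofReal_tsum_of_nonneg (fun i => sq_nonneg ‖inner ℂ (e i) x‖) h2.summable
  rw [h2.tsum_eq] at h3
  simp only [ENNReal.ofReal_pow (norm_nonneg _), ofReal_norm] at h3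
  exact h3.symm

theorem hsEnergy_adjoint {ι κ : Type*} (e : HilbertBasis ι ℂ H) (f : HilbertBasis κ ℂ H)
    (A : H →L[ℂ] H) : hsEnergy e A = hsEnergy f (ContinuousLinearMap.adjoint A) := by
  unfold hsEnergy
  simp_rw [← tsum_enorm_inner_sq f (A (e _)),
    ← tsum_enorm_inner_sq e (ContinuousLinearMap.adjoint A (f _))]
  rw [ENNReal.tsum_comm]
  refine tsum_congr fun j => tsum_congr fun i => ?_
  rw [ContinuousLinearMap.adjoint_inner_right, ← inner_conj_symm, ← ofReal_norm,
    ← ofReal_norm, RCLike.norm_conj]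

/-- The sum `∑ ‖A e_i‖ ^ 2` does not depend on the orthonormal basis. -/
theorem hsEnergy_eq {ι κ : Type*} (e : HilbertBasis ι ℂ H) (f : HilbertBasis κ ℂ H)
    (A : H →L[ℂ] H) : hsEnergy e A = hsEnergy f A :=
  (hsEnergy_adjoint e f A).trans (hsEnergy_adjoint f f A).symm

variable (H) in
/-- The index set of a fixed orthonormal basis of `H`. -/
def hsIndex : Set H := (exists_hilbertBasis ℂ H).choose

variable (H) in
/-- A fixed orthonormal basis of `H`. -/
def hsBasis : HilbertBasis (hsIndex H) ℂ H := (exists_hilbertBasis ℂ H).choose_spec.choose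

/-- `A` is a Hilbert-Schmidt operator: `∑ ‖A e_i‖ ^ 2 < ∞` for an orthonormal basis `(e_i)`
(equivalently for every one, by `hsEnergy_eq`). -/
def IsHilbertSchmidt (A : H →L[ℂ] H) : Prop := hsEnergy (hsBasis H) A < ∞

theorem isHilbertSchmidt_iff_memℓp (A : H →L[ℂ] H) :
    IsHilbertSchmidt A ↔ Memℓp (fun i => A (hsBasis H i)) 2 := by
  have key : hsEnergy (hsBasis H) A =
      ∑' i, ((‖A (hsBasis H i)‖₊ ^ 2 : NNReal) : ℝ≥0∞) := by
    simp [hsEnergy, enorm_eq_nnnorm]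
  rw [memℓp_gen_iff (by norm_num), IsHilbertSchmidt, key, lt_top_iff_ne_top,
    ENNReal.tsum_coe_ne_top_iff_summable, ← NNReal.summable_coe]
  simp

variable (H) in
/-- The linear subspace of Hilbert-Schmidt operators inside the bounded operators. -/
def hsSubmodule : Submodule ℂ (H →L[ℂ] H) where
  carrier := {A | IsHilbertSchmidt A}
  zero_mem' := by
    simp [IsHilbertSchmidt, hsEnergy]
  add_mem' := by
    intro A B hA hB
    simp only [Set.mem_ofPred_eq, isHilbertSchmidt_iff_memℓp] at *
    exact hA.add hB
  smul_mem' := by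
    intro c A hA
    simp only [Set.mem_ofPred_eq, isHilbertSchmidt_iff_memℓp] at *
    exact hA.const_smul c

variable (H) in
/-- The space `𝔖₂(H)` of Hilbert-Schmidt operators on `H`. It is a type of its own because it
carries the Hilbert-Schmidt norm and not the operator norm. -/
def HilbertSchmidt : Type _ := hsSubmodule H

namespace HilbertSchmidt

instance : AddCommGroup (HilbertSchmidt H) := inferInstanceAs (AddCommGroup (hsSubmodule H))

instance : Module ℂ (HilbertSchmidt H) := inferInstanceAs (Module ℂ (hsSubmodule H))

/-- The underlying bounded operator. -/
def toCLM : HilbertSchmidt H →ₗ[ℂ] H →L[ℂ] H := (hsSubmodule H).subtype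

theorem toCLM_injective : Function.Injective (toCLM (H := H)) := Subtype.val_injective

theorem isHilbertSchmidt (A : HilbertSchmidt H) : IsHilbertSchmidt (toCLM A) := A.2

/-- The embedding `A ↦ (A e_i)_i` into the `ℓ²` sum of copies of `H`. -/
def toLp : HilbertSchmidt H →ₗ[ℂ] lp (fun _ : hsIndex H => H) 2 where
  toFun A := ⟨fun i => toCLM A (hsBasis H i),
    (isHilbertSchmidt_iff_memℓp _).1 A.isHilbertSchmidt⟩
  map_add' A B := by
    ext i
    simp only [map_add]
    rfl
  map_smul' c A := by
    ext i
    simp only [map_smul]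
    rfl

theorem toLp_apply (A : HilbertSchmidt H) (i : hsIndex H) :
    toLp A i = toCLM A (hsBasis H i) := rfl

theorem toLp_injective : Function.Injective (toLp (H := H)) := by
  intro A B h
  apply toCLM_injective
  refine ContinuousLinearMap.ext_on
    (Submodule.dense_iff_topologicalClosure_eq_top.2 (hsBasis H).dense_span) ?_
  rintro _ ⟨i, rfl⟩
  rw [← toLp_apply, ← toLp_apply, h]

/-- The Hilbert-Schmidt norm `‖A‖₂ = (∑ ‖A e_i‖ ^ 2) ^ (1 / 2)`, see `enorm_sq_eq`. -/
instance : NormedAddCommGroup (HilbertSchmidt H) :=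
  NormedAddCommGroup.induced (HilbertSchmidt H) _ toLp toLp_injective

instance : NormedSpace ℂ (HilbertSchmidt H) :=
  NormedSpace.induced ℂ (HilbertSchmidt H) _ toLp

theorem norm_eq (A : HilbertSchmidt H) : ‖A‖ = ‖toLp A‖ := rfl

/-- `‖A‖₂ ^ 2 = ∑ ‖A e_i‖ ^ 2` for every orthonormal basis `(e_i)`. -/
theorem enorm_sq_eq {ι : Type*} (e : HilbertBasis ι ℂ H) (A : HilbertSchmidt H) :
    ‖A‖ₑ ^ 2 = ∑' i, ‖toCLM A (e i)‖ₑ ^ 2 := by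
  change _ = hsEnergy e (toCLM A)
  rw [hsEnergy_eq e (hsBasis H)]
  have h : HasSum (fun i => ‖toLp A i‖ ^ (2 : ℝ≥0∞).toReal) (‖toLp A‖ ^ (2 : ℝ≥0∞).toReal) :=
    lp.hasSum_norm (by norm_num) (toLp A)
  simp only [ENNReal.toReal_ofNat, Real.rpow_ofNat, toLp_apply, ← norm_eq] at h
  have h3 := ENNReal.ofReal_tsum_of_nonneg
    (fun i => sq_nonneg ‖toCLM A (hsBasis H i)‖) h.summable
  rw [h.tsum_eq] at h3
  simp only [ENNReal.ofReal_pow (norm_nonneg _), ofReal_norm] at h3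
  exact h3

end HilbertSchmidt

end HilbertSchmidt

/-! ### The Heisenberg group and its Schrödinger representation -/

/-- The Heisenberg group of dimension `2 n + 1`: the element with coordinates `a, b, c` is
`exp (∑ a_k X_k + ∑ b_k Y_k + c Z)`, where `[X_k, Y_k] = Z` are the nontrivial brackets. -/
@[ext]
structure HeisenbergGroup (n : ℕ) where
  a : EuclideanSpace ℝ (Fin n)
  b : EuclideanSpace ℝ (Fin n)
  c : ℝ

namespace HeisenbergGroup

variable {n : ℕ}

instance : Mul (HeisenbergGroup n) :=
  ⟨fun g h => ⟨g.a + h.a, g.b + h.b,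
    g.c + h.c + 1 / 2 * (inner ℝ g.a h.b - inner ℝ h.a g.b)⟩⟩

instance : One (HeisenbergGroup n) := ⟨⟨0, 0, 0⟩⟩

instance : Inv (HeisenbergGroup n) := ⟨fun g => ⟨-g.a, -g.b, -g.c⟩⟩

@[simp] theorem mul_a (g h : HeisenbergGroup n) : (g * h).a = g.a + h.a := rfl

@[simp] theorem mul_b (g h : HeisenbergGroup n) : (g * h).b = g.b + h.b := rfl

@[simp] theorem mul_c (g h : HeisenbergGroup n) :
    (g * h).c = g.c + h.c + 1 / 2 * (inner ℝ g.a h.b - inner ℝ h.a g.b) := rfl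

@[simp] theorem one_a : (1 : HeisenbergGroup n).a = 0 := rfl

@[simp] theorem one_b : (1 : HeisenbergGroup n).b = 0 := rfl

@[simp] theorem one_c : (1 : HeisenbergGroup n).c = 0 := rfl

@[simp] theorem inv_a (g : HeisenbergGroup n) : (g⁻¹).a = -g.a := rfl

@[simp] theorem inv_b (g : HeisenbergGroup n) : (g⁻¹).b = -g.b := rfl

@[simp] theorem inv_c (g : HeisenbergGroup n) : (g⁻¹).c = -g.c := rfl

instance : Group (HeisenbergGroup n) :=
  Group.ofLeftAxioms
    (fun x y z => by
      ext1
      · simp [add_assoc]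
      · simp [add_assoc]
      · simp only [mul_c, mul_a, mul_b, inner_add_left, inner_add_right]
        ring)
    (fun x => by ext1 <;> simp)
    (fun x => by ext1 <;> simp)

end HeisenbergGroup

/-- The Hilbert space `L²(ℝⁿ)` of complex-valued functions, for Lebesgue measure. -/
abbrev L2Space (n : ℕ) : Type :=
  Lp ℂ 2 (volume : Measure (EuclideanSpace ℝ (Fin n)))

/-- The function `x ↦ exp (i λ (c - b x + a b / 2)) f (x - a)`. -/
def schrodingerFun {n : ℕ} (lam : ℝ) (g : HeisenbergGroup n)
    (f : EuclideanSpace ℝ (Fin n) → ℂ) (x : EuclideanSpace ℝ (Fin n)) : ℂ :=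
  Complex.exp (Complex.I * ((lam * (g.c - inner ℝ g.b x + 1 / 2 * inner ℝ g.a g.b) : ℝ) : ℂ)) *
    f (x - g.a)

section Schrodinger

variable {n : ℕ} (lam : ℝ)

theorem schrodingerFun_norm (g : HeisenbergGroup n) (f : EuclideanSpace ℝ (Fin n) → ℂ)
    (x : EuclideanSpace ℝ (Fin n)) : ‖schrodingerFun lam g f x‖ = ‖f (x - g.a)‖ := by
  rw [schrodingerFun, norm_mul, mul_comm Complex.I, Complex.norm_exp_ofReal_mul_I, one_mul]

theorem schrodingerFun_congr (g : HeisenbergGroup n) {f f' : EuclideanSpace ℝ (Fin n) → ℂ}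
    (h : f =ᵐ[volume] f') : schrodingerFun lam g f =ᵐ[volume] schrodingerFun lam g f' := by
  filter_upwards [(measurePreserving_sub_right volume g.a).quasiMeasurePreserving.ae_eq_comp h]
    with x hx
  simp only [Function.comp_apply] at hx
  simp only [schrodingerFun, hx]

theorem schrodingerFun_mul (g h : HeisenbergGroup n) (f : EuclideanSpace ℝ (Fin n) → ℂ) :
    schrodingerFun lam (g * h) f = schrodingerFun lam g (schrodingerFun lam h f) := by
  funext x
  simp only [schrodingerFun, HeisenbergGroup.mul_a, HeisenbergGroup.mul_b,
    HeisenbergGroup.mul_c, ← mul_assoc, ← Complex.exp_add, ← mul_add, ← Complex.ofReal_add,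
    sub_sub, inner_add_left, inner_add_right, inner_sub_right, real_inner_comm h.b g.a]
  congr 4
  ring

theorem schrodingerFun_one (f : EuclideanSpace ℝ (Fin n) → ℂ) :
    schrodingerFun lam 1 f = f := by
  funext x
  simp [schrodingerFun]

theorem schrodingerFun_memLp (g : HeisenbergGroup n) (f : L2Space n) :
    MemLp (schrodingerFun lam g f) 2 volume := by
  have h := (Lp.memLp f).comp_measurePreserving (measurePreserving_sub_right volume g.a)
  refine h.congr_norm ?_ (Filter.Eventually.of_forall fun x => ?_)
  · refine AEStronglyMeasurable.mul (Continuous.aestronglyMeasurable ?_) h.1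
    fun_prop
  · rw [schrodingerFun_norm]
    rfl

/-- The operator `π(g)` as a linear isometry of `L²(ℝⁿ)`. -/
def schrodingerIsometry (g : HeisenbergGroup n) : L2Space n →ₗᵢ[ℂ] L2Space n where
  toFun f := (schrodingerFun_memLp lam g f).toLp
  map_add' f f' := by
    rw [← MemLp.toLp_add]
    refine MemLp.toLp_congr _ _ ?_
    refine (schrodingerFun_congr lam g (Lp.coeFn_add f f')).trans (Filter.Eventually.of_forall ?_)
    intro x
    simp [schrodingerFun, mul_add]
  map_smul' c f := by
    rw [RingHom.id_apply, ← MemLp.toLp_const_smul]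
    refine MemLp.toLp_congr _ _ ?_
    refine (schrodingerFun_congr lam g (Lp.coeFn_smul c f)).trans (Filter.Eventually.of_forall ?_)
    intro x
    simp [schrodingerFun, mul_left_comm]
  norm_map' f := by
    change ‖(schrodingerFun_memLp lam g f).toLp‖ = ‖f‖
    rw [← Lp.norm_compMeasurePreserving f (measurePreserving_sub_right volume g.a), Lp.norm_toLp,
      Lp.norm_def]
    congr 1
    refine eLpNorm_congr_norm_ae ?_
    filter_upwards [Lp.coeFn_compMeasurePreserving f (measurePreserving_sub_right volume g.a)]
      with x hx
    rw [hx, schrodingerFun_norm]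
    rfl

theorem schrodingerIsometry_coeFn (g : HeisenbergGroup n) (f : L2Space n) :
    schrodingerIsometry lam g f =ᵐ[volume] schrodingerFun lam g f :=
  MemLp.coeFn_toLp (schrodingerFun_memLp lam g f)

theorem schrodingerIsometry_mul (g h : HeisenbergGroup n) (f : L2Space n) :
    schrodingerIsometry lam (g * h) f =
      schrodingerIsometry lam g (schrodingerIsometry lam h f) := by
  refine Lp.ext ((schrodingerIsometry_coeFn lam _ _).trans ?_)
  rw [schrodingerFun_mul]
  exact ((schrodingerIsometry_coeFn lam _ _).trans
    (schrodingerFun_congr lam g (schrodingerIsometry_coeFn lam _ _))).symm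

theorem schrodingerIsometry_one (f : L2Space n) : schrodingerIsometry lam 1 f = f := by
  refine Lp.ext ((schrodingerIsometry_coeFn lam _ _).trans ?_)
  rw [schrodingerFun_one]

/-- The Schrödinger representation `π` of the Heisenberg group on `L²(ℝⁿ)` with parameter `λ`,
`(π(a, b, c) f)(x) = exp (i λ (c - b x + a b / 2)) f (x - a)`, as a homomorphism to the group of
unitary operators. -/
def schrodingerRep (n : ℕ) (lam : ℝ) : HeisenbergGroup n →* (L2Space n ≃ₗᵢ[ℂ] L2Space n) where
  toFun g :=
    { toLinearEquiv := LinearEquiv.ofLinearMap (schrodingerIsometry lam g).toLinearMap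
        (schrodingerIsometry lam g⁻¹).toLinearMap
        (by
          ext1 f
          change schrodingerIsometry lam g (schrodingerIsometry lam g⁻¹ f) = f
          rw [← schrodingerIsometry_mul, mul_inv_cancel, schrodingerIsometry_one])
        (by
          ext1 f
          change schrodingerIsometry lam g⁻¹ (schrodingerIsometry lam g f) = f
          rw [← schrodingerIsometry_mul, inv_mul_cancel, schrodingerIsometry_one])
      norm_map' := (schrodingerIsometry lam g).norm_map }
  map_one' := by
    ext1 f
    exact schrodingerIsometry_one lam f
  map_mul' g h := by
    ext1 f
    exact schrodingerIsometry_mul lam g h f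

end Schrodinger

/-! ### Gaussian coherent states and the Berezin symbol -/

/-- The Gaussian `φ(x) = (λ / π) ^ (n / 4) exp (-λ |x| ^ 2 / 2)` on `ℝⁿ`. -/
def gaussianFun (n : ℕ) (lam : ℝ) (x : EuclideanSpace ℝ (Fin n)) : ℂ :=
  (((lam / Real.pi) ^ ((n : ℝ) / 4) * Real.exp (-lam * ‖x‖ ^ 2 / 2) : ℝ) : ℂ)

theorem gaussianFun_memLp (n : ℕ) {lam : ℝ} (hlam : 0 < lam) :
    MemLp (gaussianFun n lam) 2 volume := by
  have hc : Continuous (gaussianFun n lam) := by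
    unfold gaussianFun
    fun_prop
  rw [memLp_two_iff_integrable_sq_norm hc.aestronglyMeasurable]
  have h := (GaussianFourier.integrable_cexp_neg_mul_sq_norm_add (V := EuclideanSpace ℝ (Fin n))
    (b := (lam : ℂ)) (by simpa using hlam) 0 0).norm.const_mul
    (((lam / Real.pi) ^ ((n : ℝ) / 4)) ^ 2)
  refine h.congr (Filter.Eventually.of_forall fun x => ?_)
  simp only [gaussianFun, Complex.norm_real, Complex.norm_exp, norm_mul, mul_pow, Real.norm_eq_abs,
    sq_abs, ← Real.exp_nat_mul]
  congr 2
  simp [← Complex.ofReal_pow]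
  ring

/-- The Gaussian `φ` as an element of `L²(ℝⁿ)`. -/
def gaussianVector (n : ℕ) {lam : ℝ} (hlam : 0 < lam) : L2Space n :=
  (gaussianFun_memLp n hlam).toLp

/-- The coherent states `φ_z = π(a, b, 0) φ` for `z = (a, b) ∈ ℝⁿ × ℝⁿ`. -/
def coherentState {n : ℕ} {lam : ℝ} (hlam : 0 < lam)
    (z : EuclideanSpace ℝ (Fin n) × EuclideanSpace ℝ (Fin n)) : L2Space n :=
  schrodingerRep n lam ⟨z.1, z.2, 0⟩ (gaussianVector n hlam)

/-- The Berezin covariant symbol `S(A)(z) = (A φ_z | φ_z)` of a bounded operator. Mathlib's inner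
product is linear in its second argument. -/
def berezinSymbol {n : ℕ} {lam : ℝ} (hlam : 0 < lam) (A : L2Space n →L[ℂ] L2Space n)
    (z : EuclideanSpace ℝ (Fin n) × EuclideanSpace ℝ (Fin n)) : ℂ :=
  inner ℂ (coherentState hlam z) (A (coherentState hlam z))

end

noncomputable section

/-! The structure behind all three claims is that, up to a nowhere vanishing scalar, `φ_z` is the
complex Gaussian `E_ζ(x) = exp (-λ|x|²/2 + λ ζ·x)` at `ζ = a - ib` (`coherentState_eq_smul`), and
that `ζ ↦ E_ζ` is an entire map into `L²` (`hasFDerivAt_expGaussian`).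

Boundedness: for fixed `a`, the pairing of `φ_z` with `f` is, up to a phase, the Fourier transform
in `b` of a translated Gaussian times `f`. Plancherel and Tonelli bound its square integral by
`C‖f‖²`. Apply this to `f = A* e_i`, sum over `i`, and use `|S(A)(z)| ≤ ‖φ‖ ‖A φ_z‖`.

Injectivity: a vanishing symbol says that `⟨E_ζ, A E_ξ⟩`, antiholomorphic in `ζ` and holomorphic in
`ξ`, vanishes on the diagonal. Continuation along complex lines takes it off the diagonal, to pure
modulations of a Gaussian. These are total by Fourier uniqueness, so `A = 0`
(`eq_zero_of_berezinSymbol_eq_zero`).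

Dense range: suitable rank one operators built from the `E_ζ` have as conjugate symbols a fixed
Gaussian on phase space times an arbitrary character (`exists_conj_berezinSymbol_rankOne_eq`). If
`F` is orthogonal to the range, the Gaussian times `F` has zero Fourier transform, so `F = 0`. -/

theorem eLpNorm_two_sq {α : Type*} [MeasurableSpace α] {μ : Measure α} (g : α → ℂ) :
    eLpNorm g 2 μ ^ 2 = ∫⁻ x, ‖g x‖ₑ ^ 2 ∂μ := by
  simpa using eLpNorm_nnreal_pow_eq_lintegral (f := g) (μ := μ) (p := 2) (by norm_num)

/-! ### Fourier uniqueness and Plancherel for integral transforms -/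

section Fourier

open FourierTransform SchwartzMap
open scoped ContDiff

variable {V : Type*} [NormedAddCommGroup V] [InnerProductSpace ℝ V] [FiniteDimensional ℝ V]
  [MeasurableSpace V] [BorelSpace V]

/-- A locally integrable function is determined by its integrals against Schwartz functions. -/
theorem ae_eq_of_integral_schwartz_mul_eq {f g : V → ℂ} (hf : LocallyIntegrable f)
    (hg : LocallyIntegrable g) (h : ∀ ψ : 𝓢(V, ℂ), ∫ x, ψ x * f x = ∫ x, ψ x * g x) :
    f =ᵐ[volume] g := by
  refine ae_eq_of_integral_contDiff_smul_eq hf hg fun ψ hψ hc => ?_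
  have h1 : HasCompactSupport (Complex.ofRealCLM ∘ ψ) := hc.comp_left rfl
  have h2 : ContDiff ℝ ∞ (Complex.ofRealCLM ∘ ψ) := Complex.ofRealCLM.contDiff.comp hψ
  simpa using h (h1.toSchwartzMap h2)

/-- Fubini, in the form that the transform is self-adjoint for the bilinear pairing. It moves
questions about `𝓕 f` onto Schwartz functions, where inversion is available. -/
theorem integral_schwartz_mul_fourier (ψ : 𝓢(V, ℂ)) {f : V → ℂ} (hf : Integrable f) :
    ∫ x, ψ x * 𝓕 f x = ∫ x, (𝓕 ψ) x * f x := by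
  have h := VectorFourier.integral_fourierIntegral_smul_eq_flip (μ := volume) (ν := volume)
    (L := innerₗ V) (f := f) (g := ψ)
    Real.continuous_fourierChar continuous_inner hf ψ.integrable
  simp only [smul_eq_mul, flip_innerₗ] at h
  simp_rw [SchwartzMap.fourier_coe]
  calc _ = ∫ x, 𝓕 f x * ψ x := by simp_rw [mul_comm]
    _ = _ := h
    _ = _ := by simp_rw [mul_comm]; rfl

/-- An integrable function whose Fourier transform vanishes is zero almost everywhere. -/
theorem ae_eq_zero_of_fourier_eq_zero {f : V → ℂ} (hf : Integrable f)
    (h : ∀ w : V, ∫ x, Complex.exp (Complex.I * (inner ℝ w x : ℝ)) * f x = 0) :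
    f =ᵐ[volume] 0 := by
  have h0 : 𝓕 f = 0 := by
    funext w
    -- The factor `-2π` reconciles the kernel `exp (-2πi⟨x, w⟩)` of `𝓕` with the kernel `exp (i⟨w,
    -- x⟩)` of the hypothesis.
    rw [Real.fourier_eq', Pi.zero_apply, ← h ((-2 * Real.pi) • w)]
    refine integral_congr_ae (.of_forall fun x => ?_)
    simp only [smul_eq_mul, inner_smul_left, real_inner_comm x w]
    congr 2
    simp
    ring
  refine ae_eq_of_integral_schwartz_mul_eq hf.locallyIntegrable
    (locallyIntegrable_const 0) fun ψ => ?_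
  have h1 := integral_schwartz_mul_fourier (𝓕⁻ ψ) hf
  simp only [h0, Pi.zero_apply, mul_zero, integral_zero] at h1
  rw [FourierTransform.fourier_fourierInv_eq] at h1
  simp [← h1]

/-- **Plancherel's theorem** for functions in `L¹ ∩ L²`. -/
theorem lintegral_enorm_fourier_sq {f : V → ℂ} (hf : Integrable f) (hf2 : MemLp f 2 volume) :
    ∫⁻ w, ‖𝓕 f w‖ₑ ^ 2 = ∫⁻ x, ‖f x‖ₑ ^ 2 := by
  have hc : Continuous (𝓕 f) := VectorFourier.fourierIntegral_continuous
    Real.continuous_fourierChar (by exact continuous_inner) hf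
  set F : Lp ℂ 2 (volume : Measure V) := 𝓕 (hf2.toLp f) with hF
  -- The `L²` transform and the integral transform act alike on Schwartz functions, hence agree
  -- almost everywhere; the isometry of the former then gives the claim.
  have key : F =ᵐ[volume] 𝓕 f := by
    refine ae_eq_of_integral_schwartz_mul_eq
      ((Lp.memLp F).locallyIntegrable (by norm_num)) hc.locallyIntegrable fun ψ => ?_
    rw [integral_schwartz_mul_fourier ψ hf]
    have h1 := DFunLike.congr_fun (Lp.fourier_toTemperedDistribution_eq (hf2.toLp f)) ψ
    rw [TemperedDistribution.fourier_apply, Lp.toTemperedDistribution_apply,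
      Lp.toTemperedDistribution_apply] at h1
    simp only [smul_eq_mul] at h1
    rw [← h1]
    refine integral_congr_ae ?_
    filter_upwards [hf2.coeFn_toLp] with x hx
    rw [hx]
  have h2 : eLpNorm (𝓕 f) 2 volume = eLpNorm f 2 volume := by
    rw [← eLpNorm_congr_ae key, ← eLpNorm_congr_ae hf2.coeFn_toLp, ← Lp.enorm_def, ← Lp.enorm_def,
      ← ofReal_norm, ← ofReal_norm, hF, Lp.norm_fourier_eq]
  rw [← eLpNorm_two_sq, ← eLpNorm_two_sq, h2]

end Fourier

/-! ### Complex Gaussians as an entire family in `L²` -/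

section ExpGaussian

variable {n : ℕ}

/-- The inclusion of `ℝⁿ` in `ℂⁿ`. -/
def complexify (x : EuclideanSpace ℝ (Fin n)) : EuclideanSpace ℂ (Fin n) :=
  WithLp.toLp 2 fun i => (x i : ℂ)

@[simp] theorem complexify_apply (x : EuclideanSpace ℝ (Fin n)) (i : Fin n) :
    complexify x i = (x i : ℂ) := rfl

@[simp] theorem norm_complexify (x : EuclideanSpace ℝ (Fin n)) : ‖complexify x‖ = ‖x‖ := by
  simp [EuclideanSpace.norm_eq]

theorem continuous_complexify : Continuous (complexify (n := n)) := by
  unfold complexify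
  fun_prop

/-- The bilinear pairing `ζ · x` of a complex and a real vector. -/
def dotReal (ζ : EuclideanSpace ℂ (Fin n)) (x : EuclideanSpace ℝ (Fin n)) : ℂ :=
  inner ℂ (complexify x) ζ

theorem dotReal_eq_sum (ζ : EuclideanSpace ℂ (Fin n)) (x : EuclideanSpace ℝ (Fin n)) :
    dotReal ζ x = ∑ i, ζ i * (x i : ℂ) := by
  simp [dotReal, PiLp.inner_apply]

theorem dotReal_add (ζ η : EuclideanSpace ℂ (Fin n)) (x : EuclideanSpace ℝ (Fin n)) :
    dotReal (ζ + η) x = dotReal ζ x + dotReal η x := inner_add_right _ _ _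

theorem dotReal_sub (ζ η : EuclideanSpace ℂ (Fin n)) (x : EuclideanSpace ℝ (Fin n)) :
    dotReal (ζ - η) x = dotReal ζ x - dotReal η x := inner_sub_right _ _ _

theorem dotReal_smul (c : ℂ) (ζ : EuclideanSpace ℂ (Fin n)) (x : EuclideanSpace ℝ (Fin n)) :
    dotReal (c • ζ) x = c * dotReal ζ x := inner_smul_right _ _ _

theorem dotReal_complexify (a x : EuclideanSpace ℝ (Fin n)) :
    dotReal (complexify a) x = (inner ℝ a x : ℝ) := by
  simp [dotReal_eq_sum, PiLp.inner_apply, mul_comm]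

theorem norm_dotReal_le (ζ : EuclideanSpace ℂ (Fin n)) (x : EuclideanSpace ℝ (Fin n)) :
    ‖dotReal ζ x‖ ≤ ‖ζ‖ * ‖x‖ := by
  rw [mul_comm, ← norm_complexify x]
  exact norm_inner_le_norm _ _

theorem continuous_dotReal (ζ : EuclideanSpace ℂ (Fin n)) : Continuous (dotReal ζ) :=
  continuous_complexify.inner continuous_const

/-- Completing the square, `c‖x‖ ≤ c²/λ + λ‖x‖²/4`, so a constant times the Gaussian of parameter
`λ/2` dominates. All `L²` bounds for the complex Gaussians and their derivatives reduce to this one.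
-/
theorem memLp_exp_neg_sq_add_norm {lam : ℝ} (hlam : 0 < lam) (c : ℝ) :
    MemLp (fun x : EuclideanSpace ℝ (Fin n) => Real.exp (-lam / 2 * ‖x‖ ^ 2 + c * ‖x‖)) 2
      volume := by
  have hk : 0 < (lam / 2 / Real.pi) ^ ((n : ℝ) / 4) := by positivity
  refine ((gaussianFun_memLp n (half_pos hlam)).const_mul
    ((Real.exp (c ^ 2 / lam) / (lam / 2 / Real.pi) ^ ((n : ℝ) / 4) : ℝ) : ℂ)).of_le
    (Continuous.aestronglyMeasurable (by fun_prop)) (.of_forall fun x => ?_)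
  rw [gaussianFun, ← Complex.ofReal_mul, Complex.norm_real, ← mul_assoc,
    div_mul_cancel₀ _ hk.ne', ← Real.exp_add, Real.norm_eq_abs, Real.norm_eq_abs, Real.abs_exp,
    Real.abs_exp, Real.exp_le_exp]
  have h1 : c ^ 2 / lam - c * ‖x‖ + lam / 4 * ‖x‖ ^ 2 = (c - lam / 2 * ‖x‖) ^ 2 / lam := by
    field_simp
    ring
  have h2 : 0 ≤ (c - lam / 2 * ‖x‖) ^ 2 / lam := by positivity
  linarith

/-- The function `x ↦ exp (-λ |x| ^ 2 / 2 + λ ζ · x)`. -/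
def expGaussianFun (lam : ℝ) (ζ : EuclideanSpace ℂ (Fin n)) (x : EuclideanSpace ℝ (Fin n)) : ℂ :=
  Complex.exp (-(lam / 2 : ℂ) * (‖x‖ : ℂ) ^ 2 + lam * dotReal ζ x)

theorem continuous_expGaussianFun (lam : ℝ) (ζ : EuclideanSpace ℂ (Fin n)) :
    Continuous (expGaussianFun lam ζ) := by
  have := continuous_dotReal ζ
  unfold expGaussianFun
  fun_prop

theorem norm_expGaussianFun_le {lam : ℝ} (hlam : 0 < lam) (ζ : EuclideanSpace ℂ (Fin n))
    (x : EuclideanSpace ℝ (Fin n)) :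
    ‖expGaussianFun lam ζ x‖ ≤ Real.exp (-lam / 2 * ‖x‖ ^ 2 + lam * ‖ζ‖ * ‖x‖) := by
  rw [expGaussianFun, Complex.norm_exp, Real.exp_le_exp]
  have h1 : (dotReal ζ x).re ≤ ‖ζ‖ * ‖x‖ := (Complex.re_le_norm _).trans (norm_dotReal_le ζ x)
  have h2 : (-(lam / 2 : ℂ) * (‖x‖ : ℂ) ^ 2 + lam * dotReal ζ x).re =
      -lam / 2 * ‖x‖ ^ 2 + lam * (dotReal ζ x).re := by
    have : -(lam / 2 : ℂ) * (‖x‖ : ℂ) ^ 2 = ((-lam / 2 * ‖x‖ ^ 2 : ℝ) : ℂ) := by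
      push_cast
      ring
    rw [this, Complex.add_re, Complex.ofReal_re, Complex.re_ofReal_mul]
  rw [h2]
  nlinarith [mul_le_mul_of_nonneg_left h1 hlam.le]

theorem memLp_expGaussianFun {lam : ℝ} (hlam : 0 < lam) (ζ : EuclideanSpace ℂ (Fin n)) :
    MemLp (expGaussianFun lam ζ) 2 volume :=
  (memLp_exp_neg_sq_add_norm hlam (lam * ‖ζ‖)).of_le
    (continuous_expGaussianFun lam ζ).aestronglyMeasurable
    (.of_forall fun x => (norm_expGaussianFun_le hlam ζ x).trans (Real.le_norm_self _))

theorem expGaussianFun_add (lam : ℝ) (ζ η : EuclideanSpace ℂ (Fin n))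
    (x : EuclideanSpace ℝ (Fin n)) : expGaussianFun lam (ζ + η) x =
      expGaussianFun lam ζ x * Complex.exp (lam * dotReal η x) := by
  rw [expGaussianFun, expGaussianFun, ← Complex.exp_add, dotReal_add]
  ring_nf

theorem norm_mul_dotReal_le {lam : ℝ} (hlam : 0 < lam) (η : EuclideanSpace ℂ (Fin n))
    (x : EuclideanSpace ℝ (Fin n)) : ‖(lam : ℂ) * dotReal η x‖ ≤ ‖η‖ * (lam * ‖x‖) := by
  rw [norm_mul, Complex.norm_real, Real.norm_of_nonneg hlam.le]
  nlinarith [mul_le_mul_of_nonneg_left (norm_dotReal_le η x) hlam.le]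

theorem memLp_dotReal_mul_expGaussianFun {lam : ℝ} (hlam : 0 < lam)
    (ζ η : EuclideanSpace ℂ (Fin n)) :
    MemLp (fun x => (lam * dotReal η x) * expGaussianFun lam ζ x) 2 volume := by
  refine ((memLp_exp_neg_sq_add_norm hlam (lam * ‖ζ‖ + lam)).const_mul ‖η‖).of_le
    (((continuous_const.mul (continuous_dotReal η)).mul
      (continuous_expGaussianFun lam ζ)).aestronglyMeasurable) (.of_forall fun x => ?_)
  refine le_trans ?_ (Real.le_norm_self _)
  have h1 : lam * ‖x‖ ≤ Real.exp (lam * ‖x‖) := by linarith [Real.add_one_le_exp (lam * ‖x‖)]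
  rw [norm_mul]
  calc _ ≤ (‖η‖ * Real.exp (lam * ‖x‖)) *
        Real.exp (-lam / 2 * ‖x‖ ^ 2 + lam * ‖ζ‖ * ‖x‖) := by
        gcongr
        · exact (norm_mul_dotReal_le hlam η x).trans (by gcongr)
        · exact norm_expGaussianFun_le hlam ζ x
    _ = _ := by rw [mul_assoc, ← Real.exp_add]; ring_nf

/-- The function `x ↦ exp (-λ |x| ^ 2 / 2 + λ ζ · x)` as an element of `L²(ℝⁿ)`. -/
def expGaussian {lam : ℝ} (hlam : 0 < lam) (ζ : EuclideanSpace ℂ (Fin n)) : L2Space n :=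
  (memLp_expGaussianFun hlam ζ).toLp

theorem expGaussian_coeFn {lam : ℝ} (hlam : 0 < lam) (ζ : EuclideanSpace ℂ (Fin n)) :
    expGaussian hlam ζ =ᵐ[volume] expGaussianFun lam ζ := MemLp.coeFn_toLp _

/-- The derivative of `ζ ↦ expGaussian hlam ζ`. -/
def expGaussianDeriv {lam : ℝ} (hlam : 0 < lam) (ζ : EuclideanSpace ℂ (Fin n)) :
    EuclideanSpace ℂ (Fin n) →ₗ[ℂ] L2Space n where
  toFun η := (memLp_dotReal_mul_expGaussianFun hlam ζ η).toLp
  map_add' η η' := by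
    rw [← MemLp.toLp_add]
    refine MemLp.toLp_congr _ _ (.of_forall fun x => ?_)
    simp only [dotReal_add, Pi.add_apply]
    ring
  map_smul' c η := by
    rw [RingHom.id_apply, ← MemLp.toLp_const_smul]
    refine MemLp.toLp_congr _ _ (.of_forall fun x => ?_)
    simp only [dotReal_smul, Pi.smul_apply, smul_eq_mul]
    ring

/-- The remainder is `(exp y - 1 - y) E_ζ` with `y = λ η·x`. The `2λ` in the exponent pays `λ` for
`|exp y - 1 - y| ≤ |y|² exp |y|` and `λ` for `t² ≤ 2 exp t` at `t = λ‖x‖`. -/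
theorem norm_expGaussianFun_taylor_le {lam : ℝ} (hlam : 0 < lam)
    (ζ η : EuclideanSpace ℂ (Fin n)) (hη : ‖η‖ ≤ 1) (x : EuclideanSpace ℝ (Fin n)) :
    ‖expGaussianFun lam (ζ + η) x - expGaussianFun lam ζ x -
      (lam * dotReal η x) * expGaussianFun lam ζ x‖ ≤
    2 * ‖η‖ ^ 2 * Real.exp (-lam / 2 * ‖x‖ ^ 2 + (lam * ‖ζ‖ + 2 * lam) * ‖x‖) := by
  set y : ℂ := lam * dotReal η x with hy
  have hyn : ‖y‖ ≤ ‖η‖ * (lam * ‖x‖) := norm_mul_dotReal_le hlam η x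
  have hyn' : ‖y‖ ≤ lam * ‖x‖ := hyn.trans (mul_le_of_le_one_left (by positivity) hη)
  have h1 : ‖Complex.exp y - 1 - y‖ ≤ ‖y‖ ^ 2 * Real.exp ‖y‖ := by
    have := Complex.norm_exp_sub_sum_le_norm_mul_exp y 2
    simpa [Finset.sum_range_succ, sub_sub] using this
  have h2 : (lam * ‖x‖) ^ 2 ≤ 2 * Real.exp (lam * ‖x‖) := by
    have h0 : 0 ≤ lam * ‖x‖ := by positivity
    nlinarith [Real.quadratic_le_exp_of_nonneg h0]
  have e : expGaussianFun lam (ζ + η) x - expGaussianFun lam ζ x - y * expGaussianFun lam ζ x =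
      (Complex.exp y - 1 - y) * expGaussianFun lam ζ x := by
    rw [expGaussianFun_add]
    ring
  rw [e, norm_mul]
  calc _ ≤ ((‖η‖ * (lam * ‖x‖)) ^ 2 * Real.exp (lam * ‖x‖)) *
        Real.exp (-lam / 2 * ‖x‖ ^ 2 + lam * ‖ζ‖ * ‖x‖) := by
        gcongr
        · exact h1.trans (by gcongr)
        · exact norm_expGaussianFun_le hlam ζ x
    _ ≤ (‖η‖ ^ 2 * (2 * Real.exp (lam * ‖x‖)) * Real.exp (lam * ‖x‖)) *
        Real.exp (-lam / 2 * ‖x‖ ^ 2 + lam * ‖ζ‖ * ‖x‖) := by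
        rw [mul_pow]
        gcongr
    _ = 2 * ‖η‖ ^ 2 * (Real.exp (lam * ‖x‖) * Real.exp (lam * ‖x‖) *
        Real.exp (-lam / 2 * ‖x‖ ^ 2 + lam * ‖ζ‖ * ‖x‖)) := by ring
    _ = _ := by rw [← Real.exp_add, ← Real.exp_add]; ring_nf

/-- The pointwise Taylor remainder is `‖η‖²` times an `L²` function independent of `η`, so
differentiability holds in the `L²` norm and not only pointwise. -/
theorem hasFDerivAt_expGaussian {lam : ℝ} (hlam : 0 < lam) (ζ : EuclideanSpace ℂ (Fin n)) :
    HasFDerivAt (expGaussian hlam)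
      (LinearMap.toContinuousLinearMap (expGaussianDeriv hlam ζ)) ζ := by
  rw [hasFDerivAt_iff_isLittleO_nhds_zero]
  have hD := memLp_exp_neg_sq_add_norm (n := n) hlam (lam * ‖ζ‖ + 2 * lam)
  refine Asymptotics.IsBigO.trans_isLittleO (g := fun η : EuclideanSpace ℂ (Fin n) => ‖η‖ ^ 2) ?_
    (Asymptotics.isLittleO_norm_pow_id one_lt_two)
  refine Asymptotics.IsBigO.of_bound (2 * ‖hD.toLp‖) ?_
  filter_upwards [Metric.closedBall_mem_nhds (0 : EuclideanSpace ℂ (Fin n)) one_pos] with η hη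
  rw [mem_closedBall_zero_iff] at hη
  rw [norm_pow, norm_norm, mul_right_comm]
  refine Lp.norm_le_mul_norm_of_ae_le_mul ?_
  filter_upwards [Lp.coeFn_sub (expGaussian hlam (ζ + η) - expGaussian hlam ζ)
      (expGaussianDeriv hlam ζ η), Lp.coeFn_sub (expGaussian hlam (ζ + η)) (expGaussian hlam ζ),
    expGaussian_coeFn hlam (ζ + η), expGaussian_coeFn hlam ζ, hD.coeFn_toLp,
    (memLp_dotReal_mul_expGaussianFun hlam ζ η).coeFn_toLp] with x h1 h2 h3 h4 h5 h6
  rw [LinearMap.coe_toContinuousLinearMap', h1, Pi.sub_apply, h2, Pi.sub_apply, h3, h4, h5]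
  refine (le_of_eq ?_).trans ((norm_expGaussianFun_taylor_le hlam ζ η hη x).trans
    (mul_le_mul_of_nonneg_left (Real.le_norm_self _) (by positivity)))
  rw [← h6]
  rfl

theorem differentiable_expGaussian {lam : ℝ} (hlam : 0 < lam) :
    Differentiable ℂ (expGaussian (n := n) hlam) :=
  fun ζ => (hasFDerivAt_expGaussian hlam ζ).differentiableAt

theorem inner_expGaussian {lam : ℝ} (hlam : 0 < lam) (ζ : EuclideanSpace ℂ (Fin n))
    (f : L2Space n) : inner ℂ (expGaussian hlam ζ) f =
      ∫ x, starRingEnd ℂ (expGaussianFun lam ζ x) * f x := by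
  rw [L2.inner_def]
  refine integral_congr_ae ?_
  filter_upwards [expGaussian_coeFn hlam ζ] with x hx
  rw [hx, RCLike.inner_apply, mul_comm]

end ExpGaussian

/-! ### Coherent states as complex Gaussians -/

section Coherent

variable {n : ℕ} {lam : ℝ}

theorem coherentState_coeFn (hlam : 0 < lam)
    (z : EuclideanSpace ℝ (Fin n) × EuclideanSpace ℝ (Fin n)) :
    coherentState hlam z =ᵐ[volume] schrodingerFun lam ⟨z.1, z.2, 0⟩ (gaussianFun n lam) :=
  (schrodingerIsometry_coeFn lam _ _).trans
    (schrodingerFun_congr lam _ (gaussianFun_memLp n hlam).coeFn_toLp)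

/-- The scalar relating coherent states to complex Gaussians. -/
def coherentFactor (lam : ℝ) (z : EuclideanSpace ℝ (Fin n) × EuclideanSpace ℝ (Fin n)) : ℂ :=
  ((lam / Real.pi) ^ ((n : ℝ) / 4) : ℝ) *
    Complex.exp (((-lam / 2 * ‖z.1‖ ^ 2 : ℝ) : ℂ) +
      Complex.I * ((lam / 2 * inner ℝ z.1 z.2 : ℝ) : ℂ))

theorem continuous_coherentFactor : Continuous (coherentFactor (n := n) lam) := by
  unfold coherentFactor
  fun_prop

theorem coherentFactor_ne_zero (hlam : 0 < lam)
    (z : EuclideanSpace ℝ (Fin n) × EuclideanSpace ℝ (Fin n)) :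
    coherentFactor lam z ≠ 0 := by
  have hk : 0 < (lam / Real.pi) ^ ((n : ℝ) / 4) := by positivity
  exact mul_ne_zero (by exact_mod_cast hk.ne') (Complex.exp_ne_zero _)

/-- Expanding `|x - a|²` collects the terms linear in `x` into `λ(a - ib)·x`; the terms free of `x`
form the scalar. -/
theorem coherentState_eq_smul (hlam : 0 < lam)
    (z : EuclideanSpace ℝ (Fin n) × EuclideanSpace ℝ (Fin n)) :
    coherentState hlam z = coherentFactor lam z •
      expGaussian hlam (complexify z.1 - Complex.I • complexify z.2) := by
  refine Lp.ext ?_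
  filter_upwards [coherentState_coeFn hlam z, Lp.coeFn_smul (coherentFactor lam z)
      (expGaussian hlam (complexify z.1 - Complex.I • complexify z.2)),
    expGaussian_coeFn hlam (complexify z.1 - Complex.I • complexify z.2)] with x h1 h2 h3
  rw [h1, h2, Pi.smul_apply, h3, schrodingerFun, gaussianFun, expGaussianFun, coherentFactor,
    dotReal_sub, dotReal_smul, dotReal_complexify, dotReal_complexify, smul_eq_mul,
    norm_sub_sq_real, Complex.ofReal_mul ((lam / Real.pi) ^ ((n : ℝ) / 4)), Complex.ofReal_exp,
    mul_left_comm, ← Complex.exp_add,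
    mul_assoc, ← Complex.exp_add, real_inner_comm x z.1]
  congr 2
  push_cast
  ring

theorem continuous_coherentState (hlam : 0 < lam) : Continuous (coherentState (n := n) hlam) := by
  have h : coherentState (n := n) hlam = fun z => coherentFactor lam z •
      expGaussian hlam (complexify z.1 - Complex.I • complexify z.2) :=
    funext (coherentState_eq_smul hlam)
  rw [h]
  have h1 := (differentiable_expGaussian (n := n) hlam).continuous
  have h2 := continuous_complexify (n := n)
  exact continuous_coherentFactor.smul (h1.comp (by fun_prop))

theorem continuous_berezinSymbol (hlam : 0 < lam) (A : L2Space n →L[ℂ] L2Space n) :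
    Continuous (berezinSymbol hlam A) :=
  (continuous_coherentState hlam).inner (A.continuous.comp (continuous_coherentState hlam))

end Coherent

/-! ### Square integrability and boundedness of the symbol map -/

section Bessel

open FourierTransform
open scoped NNReal

/-- A nonzero dilation is a measurable equivalence, which spares any measurability assumption on
`F`. -/
theorem lintegral_comp_smul_of_ne_zero {V : Type*} [NormedAddCommGroup V] [InnerProductSpace ℝ V]
    [FiniteDimensional ℝ V] [MeasurableSpace V] [BorelSpace V] {r : ℝ} (hr : r ≠ 0)
    (F : V → ℝ≥0∞) : ∫⁻ x, F (r • x) =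
      ENNReal.ofReal |(r ^ Module.finrank ℝ V)⁻¹| * ∫⁻ x, F x := by
  have h := lintegral_map_equiv (μ := (volume : Measure V)) F
    (Homeomorph.smulOfNeZero r hr).toMeasurableEquiv
  rw [Homeomorph.toMeasurableEquiv_coe] at h
  have h2 : Measure.map (Homeomorph.smulOfNeZero r hr) (volume : Measure V) = _ :=
    Measure.map_addHaar_smul volume hr
  rw [h2, lintegral_smul_measure] at h
  exact h.symm

variable {n : ℕ} {lam : ℝ}

theorem continuous_gaussianFun : Continuous (gaussianFun n lam) := by
  unfold gaussianFun
  fun_prop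

theorem memLp_gaussianFun_comp_sub (hlam : 0 < lam) (a : EuclideanSpace ℝ (Fin n)) :
    MemLp (fun x => gaussianFun n lam (x - a)) 2 volume :=
  (gaussianFun_memLp n hlam).comp_measurePreserving (measurePreserving_sub_right volume a)

/-- The Gaussian is bounded by its value at the origin. This is the `L²` half of the hypotheses of
Plancherel; the `L¹` half is Cauchy–Schwarz. -/
theorem memLp_gaussianFun_mul (hlam : 0 < lam) (a : EuclideanSpace ℝ (Fin n)) (f : L2Space n) :
    MemLp (fun x => gaussianFun n lam (x - a) * f x) 2 volume := by
  have hc : Continuous fun x => gaussianFun n lam (x - a) :=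
    continuous_gaussianFun.comp (continuous_sub_right a)
  refine ((Lp.memLp f).const_mul (((lam / Real.pi) ^ ((n : ℝ) / 4) : ℝ) : ℂ)).of_le
    (hc.aestronglyMeasurable.mul (Lp.aestronglyMeasurable f)) (.of_forall fun x => ?_)
  rw [norm_mul, norm_mul]
  gcongr
  rw [gaussianFun, Complex.norm_real, Complex.norm_real, norm_mul, Real.norm_eq_abs (Real.exp _),
    Real.abs_exp]
  refine mul_le_of_le_one_right (norm_nonneg _) (Real.exp_le_one_iff.2 ?_)
  have : 0 ≤ lam * ‖x - a‖ ^ 2 := by positivity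
  linarith

/-- The modulation by `b` is the Fourier kernel at frequency `-λb/(2π)`, and the remaining factor
`exp (-iλ a·b/2)` has modulus one. -/
theorem norm_inner_coherentState (hlam : 0 < lam) (a b : EuclideanSpace ℝ (Fin n))
    (f : L2Space n) : ‖inner ℂ (coherentState hlam (a, b)) f‖ =
      ‖𝓕 (fun x => gaussianFun n lam (x - a) * f x) (-(lam / (2 * Real.pi)) • b)‖ := by
  have h : inner ℂ (coherentState hlam (a, b)) f =
      Complex.exp (((-(lam / 2 * inner ℝ a b) : ℝ) : ℂ) * Complex.I) *
        𝓕 (fun x => gaussianFun n lam (x - a) * f x) (-(lam / (2 * Real.pi)) • b) := by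
    rw [L2.inner_def, Real.fourier_eq', ← integral_const_mul]
    refine integral_congr_ae ?_
    filter_upwards [coherentState_coeFn hlam (a, b)] with x hx
    rw [hx, RCLike.inner_apply, schrodingerFun, map_mul, ← Complex.exp_conj, smul_eq_mul,
      inner_smul_right, gaussianFun, Complex.conj_ofReal, map_mul, Complex.conj_I,
      Complex.conj_ofReal, real_inner_comm x b, ← mul_assoc, ← mul_assoc, ← mul_assoc,
      ← Complex.exp_add, mul_comm (f x), mul_right_comm]
    congr 3
    have := Real.pi_ne_zero
    push_cast
    field_simp
    ring
  rw [h, norm_mul, Complex.norm_exp_ofReal_mul_I, one_mul]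

theorem lintegral_inner_coherentState_snd (hlam : 0 < lam) (a : EuclideanSpace ℝ (Fin n))
    (f : L2Space n) : ∫⁻ b, ‖inner ℂ (coherentState hlam (a, b)) f‖ₑ ^ 2 =
      ENNReal.ofReal |((-(lam / (2 * Real.pi))) ^ n)⁻¹| *
        ∫⁻ x, ‖gaussianFun n lam (x - a)‖ₑ ^ 2 * ‖f x‖ₑ ^ 2 := by
  have hr : -(lam / (2 * Real.pi)) ≠ 0 := neg_ne_zero.2 (by positivity)
  have hint : Integrable (fun x => gaussianFun n lam (x - a) * f x) :=
    (memLp_gaussianFun_comp_sub hlam a).integrable_mul (Lp.memLp f)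
  have h := lintegral_comp_smul_of_ne_zero hr fun w =>
    ‖𝓕 (fun x => gaussianFun n lam (x - a) * f x) w‖ₑ ^ 2
  rw [lintegral_enorm_fourier_sq hint (memLp_gaussianFun_mul hlam a f),
    finrank_euclideanSpace_fin] at h
  simp_rw [← mul_pow, ← enorm_mul]
  rw [← h]
  refine lintegral_congr fun b => ?_
  rw [← ofReal_norm, norm_inner_coherentState, ofReal_norm]

/-- The coefficients of a function with respect to the coherent states are square integrable. -/
theorem exists_lintegral_inner_coherentState_le (n : ℕ) (hlam : 0 < lam) :
    ∃ C : ℝ≥0, ∀ f : L2Space n,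
      ∫⁻ z, ‖inner ℂ (coherentState hlam z) f‖ₑ ^ 2 ≤ C * ‖f‖ₑ ^ 2 := by
  set K := ENNReal.ofReal |((-(lam / (2 * Real.pi))) ^ n)⁻¹|
  set M := ∫⁻ x, ‖gaussianFun n lam x‖ₑ ^ 2 with hM
  have hMt : M ≠ ∞ := by
    rw [hM, ← eLpNorm_two_sq]
    exact ENNReal.pow_ne_top (gaussianFun_memLp n hlam).eLpNorm_ne_top
  refine ⟨(K * M).toNNReal, fun f => ?_⟩
  rw [ENNReal.coe_toNNReal (ENNReal.mul_ne_top ENNReal.ofReal_ne_top hMt)]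
  have hg := continuous_gaussianFun (n := n) (lam := lam)
  have hm : AEMeasurable (fun p : EuclideanSpace ℝ (Fin n) × EuclideanSpace ℝ (Fin n) =>
      ‖gaussianFun n lam (p.2 - p.1)‖ₑ ^ 2 * ‖f p.2‖ₑ ^ 2) (volume.prod volume) := by
    have h1 : Measurable fun p : EuclideanSpace ℝ (Fin n) × EuclideanSpace ℝ (Fin n) =>
        ‖gaussianFun n lam (p.2 - p.1)‖ₑ ^ 2 :=
      ((hg.comp (continuous_snd.sub continuous_fst)).measurable.enorm).pow_const 2
    exact h1.aemeasurable.mul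
      (((Lp.stronglyMeasurable f).measurable.comp measurable_snd).enorm.pow_const 2).aemeasurable
  calc ∫⁻ z, ‖inner ℂ (coherentState hlam z) f‖ₑ ^ 2
      ≤ ∫⁻ a, ∫⁻ b, ‖inner ℂ (coherentState hlam (a, b)) f‖ₑ ^ 2 := lintegral_prod_le _
    _ = K * ∫⁻ a, ∫⁻ x, ‖gaussianFun n lam (x - a)‖ₑ ^ 2 * ‖f x‖ₑ ^ 2 := by
        simp_rw [lintegral_inner_coherentState_snd hlam _ f]
        exact lintegral_const_mul' _ _ ENNReal.ofReal_ne_top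
    -- Integrating over the translation `a` first turns the Gaussian factor into the constant `M`,
    -- whatever `x` is.
    _ = K * ∫⁻ x, ∫⁻ a, ‖gaussianFun n lam (x - a)‖ₑ ^ 2 * ‖f x‖ₑ ^ 2 := by
        rw [lintegral_lintegral_swap hm]
    _ = K * ∫⁻ x, M * ‖f x‖ₑ ^ 2 := by
        congr 1
        refine lintegral_congr fun x => ?_
        rw [lintegral_mul_const' _ _ (by finiteness),
          lintegral_sub_left_eq_self (fun y => ‖gaussianFun n lam y‖ₑ ^ 2) x]
    _ = K * M * ‖f‖ₑ ^ 2 := by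
        rw [lintegral_const_mul' _ _ hMt, Lp.enorm_def, eLpNorm_two_sq, mul_assoc]

theorem enorm_coherentState (hlam : 0 < lam)
    (z : EuclideanSpace ℝ (Fin n) × EuclideanSpace ℝ (Fin n)) :
    ‖coherentState hlam z‖ₑ = ‖gaussianVector n hlam‖ₑ := by
  rw [← ofReal_norm, coherentState, LinearIsometryEquiv.norm_map, ofReal_norm]

/-- The Berezin symbol of a Hilbert-Schmidt operator is square integrable, with a bound for its
norm in terms of the Hilbert-Schmidt norm. -/
theorem exists_eLpNorm_berezinSymbol_le (n : ℕ) (hlam : 0 < lam) :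
    ∃ C : ℝ≥0, ∀ A : HilbertSchmidt (L2Space n),
      eLpNorm (berezinSymbol hlam (HilbertSchmidt.toCLM A)) 2 volume ≤ C * ‖A‖ₑ := by
  obtain ⟨C, hC⟩ := exists_lintegral_inner_coherentState_le n hlam
  set N := ‖gaussianVector n hlam‖₊
  refine ⟨N * NNReal.sqrt C, fun A => ?_⟩
  have hC2 : (C : ℝ≥0∞) = (NNReal.sqrt C : ℝ≥0∞) ^ 2 := by
    rw [← ENNReal.coe_pow, NNReal.sq_sqrt]
  set T := HilbertSchmidt.toCLM A
  set e := hsBasis (L2Space n)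
  let v : hsIndex (L2Space n) → L2Space n := fun i => ContinuousLinearMap.adjoint T (e i)
  have hA : ‖A‖ₑ ^ 2 = ∑' i, ‖v i‖ₑ ^ 2 := by
    rw [HilbertSchmidt.enorm_sq_eq e]
    exact hsEnergy_adjoint e e T
  -- The basis is not assumed countable, and exchanging integral and sum needs a countable index.
  -- Finiteness of `‖A‖₂` leaves only countably many nonzero `A* e_i`.
  have hcount : (Function.support v).Countable := by
    have h1 : ∑' i, ‖v i‖ₑ ^ 2 ≠ ∞ := by
      rw [← hA]
      finiteness
    refine (Summable.countable_support_ennreal h1).mono fun i hi => ?_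
    simpa using hi
  have : Countable (Function.support v) := hcount
  have hv (z) : ‖T (coherentState hlam z)‖ₑ ^ 2 =
      ∑' i : Function.support v, ‖inner ℂ (coherentState hlam z) (v i)‖ₑ ^ 2 := by
    rw [← tsum_enorm_inner_sq e]
    have h1 : ∀ i, ‖inner ℂ (e i) (T (coherentState hlam z))‖ₑ ^ 2 =
        ‖inner ℂ (coherentState hlam z) (v i)‖ₑ ^ 2 := fun i => by
      rw [ContinuousLinearMap.adjoint_inner_right, ← inner_conj_symm, ← ofReal_norm,
        RCLike.norm_conj, ofReal_norm]
    simp_rw [h1]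
    refine (tsum_subtype_eq_of_support_subset fun i hi => ?_).symm
    contrapose! hi
    simp [Function.notMem_support.1 hi]
  have key : eLpNorm (berezinSymbol hlam T) 2 volume ^ 2 ≤
      ((N * NNReal.sqrt C : ℝ≥0) * ‖A‖ₑ) ^ 2 := by
    rw [eLpNorm_two_sq]
    calc ∫⁻ z, ‖berezinSymbol hlam T z‖ₑ ^ 2
        ≤ ∫⁻ z, (N : ℝ≥0∞) ^ 2 * ‖T (coherentState hlam z)‖ₑ ^ 2 := by
          refine lintegral_mono fun z => ?_
          rw [← mul_pow, show (N : ℝ≥0∞) = ‖coherentState hlam z‖ₑ from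
            (enorm_coherentState hlam z).symm]
          gcongr
          rw [← ofReal_norm, ← ofReal_norm, ← ofReal_norm,
            ← ENNReal.ofReal_mul (norm_nonneg _)]
          exact ENNReal.ofReal_le_ofReal (norm_inner_le_norm _ _)
      _ = (N : ℝ≥0∞) ^ 2 * ∑' i : Function.support v,
            ∫⁻ z, ‖inner ℂ (coherentState hlam z) (v i)‖ₑ ^ 2 := by
          rw [lintegral_const_mul' _ _ (by finiteness)]
          simp_rw [hv]
          rw [lintegral_tsum fun i => ?_]
          exact ((((continuous_coherentState hlam).inner
            continuous_const).measurable.enorm).pow_const 2).aemeasurable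
      _ ≤ (N : ℝ≥0∞) ^ 2 * ∑' i : Function.support v, C * ‖v i‖ₑ ^ 2 := by
          gcongr with i
          exact hC _
      _ ≤ (N : ℝ≥0∞) ^ 2 * (C * ‖A‖ₑ ^ 2) := by
          rw [ENNReal.tsum_mul_left, hA]
          gcongr
          exact ENNReal.tsum_comp_le_tsum_of_injective Subtype.val_injective _
      _ = _ := by
          rw [hC2, ENNReal.coe_mul]
          ring
  exact (ENNReal.pow_le_pow_left_iff two_ne_zero).1 key

theorem memLp_berezinSymbol (hlam : 0 < lam) (A : HilbertSchmidt (L2Space n)) :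
    MemLp (berezinSymbol hlam (HilbertSchmidt.toCLM A)) 2 volume := by
  obtain ⟨C, hC⟩ := exists_eLpNorm_berezinSymbol_le n hlam
  exact ⟨(continuous_berezinSymbol hlam _).aestronglyMeasurable,
    (hC A).trans_lt (by finiteness)⟩

/-- The Berezin transform as a bounded operator from Hilbert-Schmidt operators to `L²`. -/
theorem exists_continuousLinearMap_berezinSymbol (n : ℕ) (hlam : 0 < lam) :
    ∃ S : HilbertSchmidt (L2Space n) →L[ℂ]
        Lp ℂ 2 (volume : Measure (EuclideanSpace ℝ (Fin n) × EuclideanSpace ℝ (Fin n))),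
      ∀ A : HilbertSchmidt (L2Space n),
        S A =ᵐ[volume] berezinSymbol hlam (HilbertSchmidt.toCLM A) := by
  obtain ⟨C, hC⟩ := exists_eLpNorm_berezinSymbol_le n hlam
  let S : HilbertSchmidt (L2Space n) →ₗ[ℂ]
      Lp ℂ 2 (volume : Measure (EuclideanSpace ℝ (Fin n) × EuclideanSpace ℝ (Fin n))) :=
    { toFun := fun A => (memLp_berezinSymbol hlam A).toLp
      map_add' := fun A B => by
        rw [← MemLp.toLp_add]
        refine MemLp.toLp_congr _ _ (.of_forall fun z => ?_)
        simp [berezinSymbol, inner_add_right]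
      map_smul' := fun c A => by
        rw [RingHom.id_apply, ← MemLp.toLp_const_smul]
        refine MemLp.toLp_congr _ _ (.of_forall fun z => ?_)
        simp [berezinSymbol, inner_smul_right] }
  refine ⟨S.mkContinuous C fun A => ?_, fun A => (memLp_berezinSymbol hlam A).coeFn_toLp⟩
  have h := hC A
  rw [← Lp.enorm_toLp (memLp_berezinSymbol hlam A), enorm_eq_nnnorm, enorm_eq_nnnorm,
    ← ENNReal.coe_mul, ENNReal.coe_le_coe] at h
  exact_mod_cast h

end Bessel

/-! ### Injectivity by analytic continuation off the diagonal -/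

section Injectivity

open scoped ComplexConjugate

/-- The inner product of an antiholomorphic and a holomorphic curve is holomorphic. -/
theorem differentiable_inner_comp_conj {H : Type*} [NormedAddCommGroup H] [InnerProductSpace ℂ H]
    {f g : ℂ → H} (hf : Differentiable ℂ f) (hg : Differentiable ℂ g) :
    Differentiable ℂ fun t : ℂ => inner ℂ (f (conj t)) (g t) := by
  intro t
  have h1 : HasFDerivAt (fun s : ℂ => f (conj s))
      (((fderiv ℂ f (conj t)).restrictScalars ℝ).comp Complex.conjCLE.toContinuousLinearMap) t :=
    HasFDerivAt.comp (g := f) t ((hf (conj t)).hasFDerivAt.restrictScalars ℝ)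
      Complex.conjCLE.toContinuousLinearMap.hasFDerivAt
  have h2 := (hg t).hasFDerivAt.restrictScalars ℝ
  have h3 := h1.inner ℂ h2
  -- The real derivative is complex linear: the conjugation of the parameter of `f` cancels the
  -- antilinearity of the inner product in its first slot.
  refine (hasFDerivAt_of_restrictScalars ℝ h3 (f' := ContinuousLinearMap.toSpanSingleton ℂ
    (inner ℂ (f (conj t)) (fderiv ℂ g t 1) +
      inner ℂ (fderiv ℂ f (conj t) 1) (g t))) ?_).differentiableAt
  refine ContinuousLinearMap.ext fun s => ?_
  have e1 : fderiv ℂ g t s = s • fderiv ℂ g t 1 := by rw [← map_smul, smul_eq_mul, mul_one]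
  have e2 : fderiv ℂ f (conj t) (conj s) = conj s • fderiv ℂ f (conj t) 1 := by
    rw [← map_smul, smul_eq_mul, mul_one]
  simp [fderivInnerCLM_apply, e1, e2, inner_smul_left, inner_smul_right, mul_add]

/-- An entire function vanishing on the real line is zero. -/
theorem eq_zero_of_forall_ofReal_eq_zero {h : ℂ → ℂ} (hh : Differentiable ℂ h)
    (h0 : ∀ t : ℝ, h t = 0) (z : ℂ) : h z = 0 := by
  have ha : AnalyticOnNhd ℂ h Set.univ := fun z _ => hh.analyticAt z
  have hfreq : ∃ᶠ w in nhdsWithin (0 : ℂ) {0}ᶜ, h w = (fun _ => 0) w := by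
    have ht : Filter.Tendsto (fun t : ℝ => (t : ℂ)) (nhdsWithin 0 {0}ᶜ)
        (nhdsWithin 0 {0}ᶜ) := by
      refine tendsto_nhdsWithin_iff.2 ⟨?_, ?_⟩
      · exact (Complex.continuous_ofReal.tendsto' 0 0 rfl).mono_left nhdsWithin_le_nhds
      · filter_upwards [self_mem_nhdsWithin] with t ht
        simpa using ht
    exact ht.frequently (Filter.Frequently.of_forall fun t => h0 t)
  exact congrFun (ha.eq_of_frequently_eq (fun z _ => analyticAt_const) hfreq) z

variable {n : ℕ} {lam : ℝ}

/-- A function orthogonal to all modulated Gaussians is zero. -/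
theorem eq_zero_of_inner_expGaussian_eq_zero (hlam : 0 < lam) (f : L2Space n)
    (h : ∀ b : EuclideanSpace ℝ (Fin n),
      inner ℂ (expGaussian hlam (-Complex.I • complexify b)) f = 0) : f = 0 := by
  have hint : Integrable fun x => expGaussianFun lam 0 x * f x :=
    (memLp_expGaussianFun hlam 0).integrable_mul (Lp.memLp f)
  -- Taking `b = λ⁻¹ w` cancels the `λ` in the exponent, so the hypothesis becomes the vanishing of
  -- the Fourier transform of the Gaussian times `f`.
  have key := ae_eq_zero_of_fourier_eq_zero hint fun w => by
    rw [← h (lam⁻¹ • w), inner_expGaussian]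
    refine integral_congr_ae (.of_forall fun x => ?_)
    simp only [expGaussianFun, dotReal_smul, dotReal_complexify, inner_smul_left]
    rw [← mul_assoc, ← Complex.exp_add, ← Complex.exp_conj]
    congr 2
    have : (lam : ℂ) ≠ 0 := by exact_mod_cast hlam.ne'
    simp [dotReal, Complex.conj_ofReal, map_ofNat]
    field_simp
    ring
  refine Lp.ext ?_
  filter_upwards [key, Lp.coeFn_zero ℂ 2 (volume : Measure (EuclideanSpace ℝ (Fin n)))]
    with x hx h0
  rw [h0]
  exact (mul_eq_zero.1 hx).resolve_left (Complex.exp_ne_zero _)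

/-- A bounded operator is determined by its Berezin symbol. -/
theorem eq_zero_of_berezinSymbol_eq_zero (hlam : 0 < lam) (A : L2Space n →L[ℂ] L2Space n)
    (h : ∀ z, berezinSymbol hlam A z = 0) : A = 0 := by
  have hdiag (a b : EuclideanSpace ℝ (Fin n)) :
      inner ℂ (expGaussian hlam (complexify a - Complex.I • complexify b))
        (A (expGaussian hlam (complexify a - Complex.I • complexify b))) = 0 := by
    have h1 := h (a, b)
    have hc := coherentFactor_ne_zero hlam (a, b)
    rw [berezinSymbol, coherentState_eq_smul, map_smul, inner_smul_left, inner_smul_right] at h1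
    simpa [hc] using h1
  have hoff (b b' : EuclideanSpace ℝ (Fin n)) :
      inner ℂ (expGaussian hlam (-Complex.I • complexify b'))
        (A (expGaussian hlam (-Complex.I • complexify b))) = 0 := by
    -- On the line `t ↦ tp - iq`, real `t` gives diagonal pairs, while at `t = -i` the two slots,
    -- with parameters `conj t` and `t`, become `-ib'` and `-ib`.
    set p := complexify ((1 / 2 : ℝ) • (b - b'))
    set q := complexify ((1 / 2 : ℝ) • (b + b'))
    have hE : Differentiable ℂ fun t : ℂ => expGaussian hlam (t • p - Complex.I • q) :=
      (differentiable_expGaussian hlam).comp (by fun_prop)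
    have hh := differentiable_inner_comp_conj hE (A.differentiable.comp hE)
    have h0 := eq_zero_of_forall_ofReal_eq_zero hh (fun t => ?_) (-Complex.I)
    · have e1 : conj (-Complex.I) • p - Complex.I • q = -Complex.I • complexify b' := by
        ext i
        simp [p, q]
        ring
      have e2 : -Complex.I • p - Complex.I • q = -Complex.I • complexify b := by
        ext i
        simp [p, q]
        ring
      simpa only [e1, e2, Function.comp_apply] using h0
    · have e : (t : ℂ) • p = complexify (t • (1 / 2 : ℝ) • (b - b')) := by
        ext i
        simp [p]
      simp only [Complex.conj_ofReal, Function.comp_apply, e]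
      exact hdiag _ _
  have hA (b : EuclideanSpace ℝ (Fin n)) : A (expGaussian hlam (-Complex.I • complexify b)) = 0 :=
    eq_zero_of_inner_expGaussian_eq_zero hlam _ fun b' => hoff b b'
  -- `A` kills a total family, so every value of its adjoint is orthogonal to that family.
  have hadj : ContinuousLinearMap.adjoint A = 0 := by
    refine ContinuousLinearMap.ext fun f => ?_
    refine eq_zero_of_inner_expGaussian_eq_zero hlam _ fun b => ?_
    rw [ContinuousLinearMap.adjoint_inner_right, hA, inner_zero_left]
  rw [← ContinuousLinearMap.adjoint_adjoint A, hadj, map_zero]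

end Injectivity

/-! ### Density of the range through rank one operators -/

section DenseRange

open scoped ComplexConjugate

variable {n : ℕ} {lam : ℝ}

/-- The inner product of two complex Gaussians. -/
theorem inner_expGaussian_expGaussian (hlam : 0 < lam) (ζ ξ : EuclideanSpace ℂ (Fin n)) :
    inner ℂ (expGaussian hlam ζ) (expGaussian hlam ξ) =
      (Real.pi / lam : ℂ) ^ (n / 2 : ℂ) *
        Complex.exp (lam / 4 * ∑ i, (starRingEnd ℂ (ζ i) + ξ i) ^ 2) := by
  have h1 : inner ℂ (expGaussian hlam ζ) (expGaussian hlam ξ) =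
      ∫ x, starRingEnd ℂ (expGaussianFun lam ζ x) * expGaussianFun lam ξ x := by
    rw [inner_expGaussian]
    refine integral_congr_ae ?_
    filter_upwards [expGaussian_coeFn hlam ξ] with x hx
    rw [hx]
  have hl : (lam : ℂ) ≠ 0 := by exact_mod_cast hlam.ne'
  have h2 := GaussianFourier.integral_cexp_neg_mul_sum_add (b := (lam : ℂ)) (by simpa using hlam)
    (fun i : Fin n => lam * (starRingEnd ℂ (ζ i) + ξ i))
  -- The Gaussian integral is known over the plain function space `Fin n → ℝ`, so the integral is
  -- transported there.
  rw [h1, ← (PiLp.volume_preserving_toLp (Fin n)).integral_comp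
    (MeasurableEquiv.toLp 2 _).measurableEmbedding]
  rw [Fintype.card_fin] at h2
  convert h2 using 1
  · refine integral_congr_ae (.of_forall fun x => ?_)
    simp only [expGaussianFun, dotReal_eq_sum]
    rw [← Complex.exp_conj, ← Complex.exp_add]
    congr 1
    have hn : ((‖WithLp.toLp 2 x‖ : ℝ) : ℂ) ^ 2 = ∑ i, (x i : ℂ) ^ 2 := by
      rw [← Complex.ofReal_pow, EuclideanSpace.norm_sq_eq]
      simp
    have hs : ∑ i, (lam : ℂ) * (starRingEnd ℂ (ζ i) + ξ i) * (x i : ℂ) =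
        lam * ∑ i, starRingEnd ℂ (ζ i) * (x i : ℂ) + lam * ∑ i, ξ i * (x i : ℂ) := by
      simp only [Finset.mul_sum, ← Finset.sum_add_distrib]
      exact Finset.sum_congr rfl fun i _ => by ring
    rw [hs]
    simp only [map_add, map_mul, map_neg, map_pow, map_sum, Complex.conj_ofReal, map_div₀, hn,
      map_ofNat]
    ring
  · congr 2
    simp only [mul_pow, ← Finset.mul_sum]
    field_simp

theorem isHilbertSchmidt_rankOne {H : Type*} [NormedAddCommGroup H] [InnerProductSpace ℂ H]
    [CompleteSpace H] (f g : H) : IsHilbertSchmidt (InnerProductSpace.rankOne ℂ f g) := by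
  have h : ∀ i, ‖InnerProductSpace.rankOne ℂ f g (hsBasis H i)‖ₑ ^ 2 =
      ‖inner ℂ (hsBasis H i) g‖ₑ ^ 2 * ‖f‖ₑ ^ 2 := fun i => by
    rw [InnerProductSpace.rankOne_apply, enorm_smul, mul_pow, ← inner_conj_symm g, ← ofReal_norm,
      RCLike.norm_conj, ofReal_norm]
  rw [IsHilbertSchmidt, hsEnergy]
  simp_rw [h]
  rw [ENNReal.tsum_mul_right, tsum_enorm_inner_sq]
  finiteness

theorem berezinSymbol_rankOne (hlam : 0 < lam) (f g : L2Space n)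
    (z : EuclideanSpace ℝ (Fin n) × EuclideanSpace ℝ (Fin n)) :
    berezinSymbol hlam (InnerProductSpace.rankOne ℂ f g) z =
      inner ℂ g (coherentState hlam z) * inner ℂ (coherentState hlam z) f := by
  rw [berezinSymbol, InnerProductSpace.rankOne_apply, inner_smul_right]

/-- The phase cancels. The surviving `exp (-λ|a|²)` turns the growing `exp (λ|a|²/2)` from the
Gaussian pairings into a decaying Gaussian. -/
theorem conj_coherentFactor_mul_self
    (z : EuclideanSpace ℝ (Fin n) × EuclideanSpace ℝ (Fin n)) :
    conj (coherentFactor lam z) * coherentFactor lam z =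
      (((lam / Real.pi) ^ ((n : ℝ) / 4) : ℝ) : ℂ) ^ 2 *
        Complex.exp ((-lam * ‖z.1‖ ^ 2 : ℝ) : ℂ) := by
  rw [coherentFactor, map_mul, Complex.conj_ofReal, ← Complex.exp_conj, mul_mul_mul_comm,
    ← Complex.exp_add, ← sq, map_add, map_mul, Complex.conj_I, Complex.conj_ofReal,
    Complex.conj_ofReal]
  congr 2
  push_cast
  ring

/-- Modulated Gaussians on phase space are, up to scalars, Berezin symbols of operators of
rank one. -/
theorem exists_conj_berezinSymbol_rankOne_eq (hlam : 0 < lam) (p q : EuclideanSpace ℝ (Fin n)) :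
    ∃ (f g : L2Space n) (C : ℂ), C ≠ 0 ∧ ∀ z,
      conj (berezinSymbol hlam (InnerProductSpace.rankOne ℂ f g) z) =
        C * (Complex.exp (Complex.I * ((inner ℝ p z.1 + inner ℝ q z.2 : ℝ) : ℂ)) *
          (expGaussianFun lam 0 z.1 * expGaussianFun lam 0 z.2)) := by
  have hl : (lam : ℂ) ≠ 0 := by exact_mod_cast hlam.ne'
  have hπ : (Real.pi : ℂ) ≠ 0 := by exact_mod_cast Real.pi_ne_zero
  have hk : 0 < (lam / Real.pi) ^ ((n : ℝ) / 4) := by positivity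
  -- These solve `η + conj ξ = 2ip/λ` and `η - conj ξ = 2q/λ`, so the part of the exponent linear in
  -- `(a, b)` is `i(p·a + q·b)`. The part free of `z` is `s`.
  set η : EuclideanSpace ℂ (Fin n) :=
    (lam⁻¹ : ℂ) • (Complex.I • complexify p + complexify q) with hη
  set ξ : EuclideanSpace ℂ (Fin n) :=
    (lam⁻¹ : ℂ) • (-Complex.I • complexify p - complexify q) with hξ
  set s : ℂ := ∑ i, (η i ^ 2 + conj (ξ i) ^ 2) with hs
  refine ⟨expGaussian hlam ξ, expGaussian hlam η,
    (((lam / Real.pi) ^ ((n : ℝ) / 4) : ℝ) : ℂ) ^ 2 *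
      ((Real.pi / lam : ℂ) ^ (n / 2 : ℂ)) ^ 2 * Complex.exp (lam / 4 * s), ?_, fun z => ?_⟩
  · refine mul_ne_zero (mul_ne_zero (pow_ne_zero 2 (by exact_mod_cast hk.ne'))
      (pow_ne_zero 2 ?_)) (Complex.exp_ne_zero _)
    exact fun h => div_ne_zero hπ hl ((Complex.cpow_eq_zero_iff _ _).1 h).1
  · have hsum : ∑ i, (conj ((complexify z.1 - Complex.I • complexify z.2) i) + η i) ^ 2 +
        ∑ i, (conj (ξ i) + (complexify z.1 - Complex.I • complexify z.2) i) ^ 2 =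
        2 * (‖z.1‖ : ℂ) ^ 2 - 2 * (‖z.2‖ : ℂ) ^ 2 +
          4 / lam * (Complex.I * ((inner ℝ p z.1 + inner ℝ q z.2 : ℝ) : ℂ)) + s := by
      have e1 (x : EuclideanSpace ℝ (Fin n)) : (‖x‖ : ℂ) ^ 2 = ∑ i, (x i : ℂ) ^ 2 := by
        rw [← Complex.ofReal_pow, EuclideanSpace.norm_sq_eq]
        simp
      have e2 (x y : EuclideanSpace ℝ (Fin n)) :
          ((inner ℝ x y : ℝ) : ℂ) = ∑ i, (x i : ℂ) * (y i : ℂ) := by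
        rw [← dotReal_complexify, dotReal_eq_sum]
        rfl
      rw [e1, e1, Complex.ofReal_add, e2, e2, hs]
      simp only [Finset.mul_sum, ← Finset.sum_add_distrib, ← Finset.sum_sub_distrib]
      refine Finset.sum_congr rfl fun i _ => ?_
      simp [hη, hξ]
      field_simp
      ring_nf
      simp only [Complex.I_sq]
      ring
    rw [berezinSymbol_rankOne, map_mul, inner_conj_symm, inner_conj_symm, coherentState_eq_smul,
      inner_smul_left, inner_smul_right, inner_expGaussian_expGaussian,
      inner_expGaussian_expGaussian, mul_mul_mul_comm, conj_coherentFactor_mul_self,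
      mul_mul_mul_comm ((Real.pi / lam : ℂ) ^ (n / 2 : ℂ)), ← Complex.exp_add, ← mul_add, hsum,
      expGaussianFun, expGaussianFun]
    have hexp : Complex.exp ((-lam * ‖z.1‖ ^ 2 : ℝ) : ℂ) * Complex.exp (lam / 4 *
          (2 * (‖z.1‖ : ℂ) ^ 2 - 2 * (‖z.2‖ : ℂ) ^ 2 +
            4 / lam * (Complex.I * ((inner ℝ p z.1 + inner ℝ q z.2 : ℝ) : ℂ)) + s)) =
        Complex.exp (lam / 4 * s) *
          (Complex.exp (Complex.I * ((inner ℝ p z.1 + inner ℝ q z.2 : ℝ) : ℂ)) *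
            (Complex.exp (-(lam / 2 : ℂ) * (‖z.1‖ : ℂ) ^ 2 + lam * dotReal 0 z.1) *
              Complex.exp (-(lam / 2 : ℂ) * (‖z.2‖ : ℂ) ^ 2 + lam * dotReal 0 z.2))) := by
      simp only [← Complex.exp_add]
      congr 1
      simp only [dotReal, inner_zero_right]
      push_cast
      field_simp
      ring
    linear_combination ((((lam / Real.pi) ^ ((n : ℝ) / 4) : ℝ) : ℂ) ^ 2 *
      ((Real.pi / lam : ℂ) ^ (n / 2 : ℂ)) ^ 2) * hexp

theorem memLp_expGaussianFun_prod (hlam : 0 < lam) :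
    MemLp (fun z : EuclideanSpace ℝ (Fin n) × EuclideanSpace ℝ (Fin n) =>
      expGaussianFun lam 0 z.1 * expGaussianFun lam 0 z.2) 2 volume := by
  have hc := continuous_expGaussianFun (n := n) lam 0
  have h := memLp_expGaussianFun (n := n) hlam 0
  rw [memLp_two_iff_integrable_sq_norm hc.aestronglyMeasurable] at h
  rw [memLp_two_iff_integrable_sq_norm (Continuous.aestronglyMeasurable (by fun_prop))]
  refine (h.mul_prod h).congr (.of_forall fun z => ?_)
  simp only [norm_mul, mul_pow]

/-- A square integrable function on phase space orthogonal to the Berezin symbols of all operators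
of rank one is zero. -/
theorem eq_zero_of_integral_conj_berezinSymbol_rankOne_eq_zero (hlam : 0 < lam)
    (F : Lp ℂ 2 (volume : Measure (EuclideanSpace ℝ (Fin n) × EuclideanSpace ℝ (Fin n))))
    (h : ∀ f g : L2Space n,
      ∫ z, conj (berezinSymbol hlam (InnerProductSpace.rankOne ℂ f g) z) * F z = 0) : F = 0 := by
  set G : EuclideanSpace ℝ (Fin n) × EuclideanSpace ℝ (Fin n) → ℂ := fun z =>
    expGaussianFun lam 0 z.1 * expGaussianFun lam 0 z.2 * F z with hG
  have hint : Integrable G := (memLp_expGaussianFun_prod hlam).integrable_mul (Lp.memLp F)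
  have hF (p q : EuclideanSpace ℝ (Fin n)) :
      ∫ z, Complex.exp (Complex.I * ((inner ℝ p z.1 + inner ℝ q z.2 : ℝ) : ℂ)) * G z = 0 := by
    obtain ⟨f, g, C, hC, hfg⟩ := exists_conj_berezinSymbol_rankOne_eq hlam p q
    have h1 := h f g
    simp_rw [hfg, mul_assoc C] at h1
    rw [integral_const_mul] at h1
    simpa only [hG, mul_assoc] using (mul_eq_zero.1 h1).resolve_left hC
  -- The product carries the sup norm and no inner product; Fourier uniqueness is applied on its
  -- `WithLp 2` copy, which has the same volume.
  have hmp := WithLp.volume_preserving_ofLp (EuclideanSpace ℝ (Fin n)) (EuclideanSpace ℝ (Fin n))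
  have hemb := (MeasurableEquiv.toLp 2
    (EuclideanSpace ℝ (Fin n) × EuclideanSpace ℝ (Fin n))).symm.measurableEmbedding
  have h0 := ae_eq_zero_of_fourier_eq_zero ((hmp.integrable_comp_emb hemb).2 hint) fun w => by
    rw [← hF w.fst w.snd, ← hmp.integral_comp hemb]
    rfl
  have hmp' := WithLp.volume_preserving_toLp (EuclideanSpace ℝ (Fin n)) (EuclideanSpace ℝ (Fin n))
  refine Lp.ext ?_
  filter_upwards [hmp'.quasiMeasurePreserving.ae_eq_comp h0, Lp.coeFn_zero ℂ 2
    (volume : Measure (EuclideanSpace ℝ (Fin n) × EuclideanSpace ℝ (Fin n)))] with z hz hz0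
  rw [hz0]
  exact (mul_eq_zero.1 hz).resolve_left
    (mul_ne_zero (Complex.exp_ne_zero _) (Complex.exp_ne_zero _))

end DenseRange

end

/-! ### The symbol map on Hilbert–Schmidt operators -/

theorem corollary3p5 (n : ℕ) {lam : ℝ} (hlam : 0 < lam) :
    ∃ S : HilbertSchmidt (L2Space n) →L[ℂ]
        Lp ℂ 2 (volume : Measure (EuclideanSpace ℝ (Fin n) × EuclideanSpace ℝ (Fin n))),
      (∀ A : HilbertSchmidt (L2Space n),
        S A =ᵐ[volume] berezinSymbol hlam (HilbertSchmidt.toCLM A)) ∧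
      Function.Injective S ∧ DenseRange S := by
  obtain ⟨S, hS⟩ := exists_continuousLinearMap_berezinSymbol n hlam
  refine ⟨S, hS, ?_, ?_⟩
  · refine (injective_iff_map_eq_zero S).2 fun A hA => ?_
    have h1 : berezinSymbol hlam (HilbertSchmidt.toCLM A) =ᵐ[volume] 0 := by
      refine (hS A).symm.trans ?_
      rw [hA]
      exact Lp.coeFn_zero _ _ _
    -- The symbol is continuous, so vanishing almost everywhere becomes vanishing at every `z`, as
    -- analytic continuation requires.
    have h2 := (continuous_berezinSymbol hlam (HilbertSchmidt.toCLM A)).ae_eq_iff_eq volume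
      continuous_zero |>.1 h1
    exact HilbertSchmidt.toCLM_injective
      ((eq_zero_of_berezinSymbol_eq_zero hlam _ (congrFun h2)).trans (map_zero _).symm)
  · have hdense : Dense (S.range : Set (Lp ℂ 2 (volume :
        Measure (EuclideanSpace ℝ (Fin n) × EuclideanSpace ℝ (Fin n))))) := by
      -- In a Hilbert space, density of a subspace amounts to a trivial orthogonal complement, and
      -- rank one operators suffice to test it.
      rw [Submodule.dense_iff_topologicalClosure_eq_top,
        Submodule.topologicalClosure_eq_top_iff, Submodule.eq_bot_iff]
      intro F hF
      refine eq_zero_of_integral_conj_berezinSymbol_rankOne_eq_zero hlam F fun f g => ?_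
      let A : HilbertSchmidt (L2Space n) := ⟨_, isHilbertSchmidt_rankOne f g⟩
      have h1 : inner ℂ (S A) F = 0 := (Submodule.mem_orthogonal _ _).1 hF _ ⟨A, rfl⟩
      rw [← h1, L2.inner_def]
      refine integral_congr_ae ?_
      filter_upwards [hS A] with z hz
      rw [hz, RCLike.inner_apply, mul_comm]
      rfl
    exact hdense
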